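/- Let $K$ be an algebraically closed field of characteristic zero, let $a \ge 1$ and $b \ge 2$, put $N = ab+a+b$, and let $X = \sigma(\mathbb{P}^a \times \mathbb{P}^b) \subset \mathbb{P}^N$ be the Segre variety, the image of $\sigma([u],[v]) = [u_i v_j]$. Let $$\mathrm{Sec}(X) = \overline{\bigcup_{x_1 \ne x_2,\ x_i \in X} \langle x_1, x_2\rangle}, \qquad \mathrm{Tan}(X) = \bigcup_{x\in X} T_xX$$ be the secant and the tangent variety of $X$, where $T_xX \subset \mathbb{P}^N$ is the embedded projective tangent space. For a closed point $q \in \mathbb{P}^N \setminus X$ let the secant locus $\Sigma_q(X)$ be the set of all points $x \in X$ for which the line $\langle q,x\rangle$ is a secant line of $X$, that is, contains a second point of $X$ or is tangent to $X$ at $x$. For $s \in \mathbb{Z}$ let $SL_s(X)$ be the set of closed points $q \in \mathbb{P}^N$ with $\dim \Sigma_q(X) = s$, where $\dim \emptyset = -1$ and where $\dim \Sigma_q(X)$ is taken to be $\dim X$ if $q \in X$. Then for every closed point $q \in \mathrm{Sec}(X) \setminus X$ the secant locus $\Sigma_q(X)$ is a smooth quadric surface (a smooth quadric in a three-dimensional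 linear subspace of $\mathbb{P}^N$). Moreover $\mathrm{Sec}(X) = \mathrm{Tan}(X)$ and $\dim \mathrm{Tan}(X) = 2(a+b)-1$. The secant stratification of $X$ is $$\mathbb{P}^N = SL_{-1}(X) \cup SL_2(X) \cup SL_{a+b}(X),$$ where $SL_2(X) = \mathrm{Sec}(X) \setminus X$ and $SL_{a+b}(X) = X$. -/

import Mathlib

open scoped LinearAlgebra.Projectivization

noncomputable section

namespace SecantLoci

variable {K : Type*} [Field K] {σ : Type*} [Fintype σ]

/-- The affine cone over a set `Y` of points of the projective space `ℙ(K^σ)`: the origin together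
with all vectors that represent a point of `Y`. -/
def affineCone (Y : Set (ℙ K (σ → K))) : Set (σ → K) :=
  {v | ∀ hv : v ≠ 0, Projectivization.mk K v hv ∈ Y}

/-- The ideal of a set of points of projective space in the homogeneous coordinate ring `K[x_i]`.
For infinite `K` it is a homogeneous ideal, generated by the forms vanishing on `Y` (by the
irrelevant ideal `(x_i)` if `Y` is empty). -/
def homogeneousIdeal (Y : Set (ℙ K (σ → K))) : Ideal (MvPolynomial σ K) :=
  MvPolynomial.vanishingIdeal K (affineCone Y)

/-- The closure of `Y` in the Zariski topology of projective space. -/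
def zariskiClosure (Y : Set (ℙ K (σ → K))) : Set (ℙ K (σ → K)) :=
  {p | ∀ F ∈ homogeneousIdeal Y, MvPolynomial.eval p.rep F = 0}

/-- `HasDim Y d`: the (closed) set `Y` has dimension `d`, i.e. the Krull dimension of its
homogeneous coordinate ring is `d + 1`.  The empty set has dimension `-1`. -/
def HasDim (Y : Set (ℙ K (σ → K))) (d : ℤ) : Prop :=
  ∃ n : ℕ, ringKrullDim (MvPolynomial σ K ⧸ homogeneousIdeal Y) = (n : WithBot ℕ∞) ∧
    d = (n : ℤ) - 1

/-- The projective line spanned by two distinct points (just `{x}` if `x = y`). -/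
def line (x y : ℙ K (σ → K)) : Set (ℙ K (σ → K)) :=
  {p | p.submodule ≤ x.submodule ⊔ y.submodule}

/-- The embedded projective tangent space `T_x X`, cut out by the differentials at `x` of the
polynomials in the ideal of `X`. -/
def tangentSpace (X : Set (ℙ K (σ → K))) (x : ℙ K (σ → K)) : Set (ℙ K (σ → K)) :=
  {p | ∀ F ∈ homogeneousIdeal X,
    ∑ i, p.rep i * MvPolynomial.eval x.rep (MvPolynomial.pderiv i F) = 0}

/-- The tangent variety `Tan(X)`, the union of all embedded tangent spaces. -/
def tangentVariety (X : Set (ℙ K (σ → K))) : Set (ℙ K (σ → K)) :=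
  {p | ∃ x ∈ X, p ∈ tangentSpace X x}

/-- The secant variety `Sec(X)`, the closure of the union of all lines through two distinct
points of `X`. -/
def secantVariety (X : Set (ℙ K (σ → K))) : Set (ℙ K (σ → K)) :=
  zariskiClosure {p | ∃ x ∈ X, ∃ y ∈ X, x ≠ y ∧ p ∈ line x y}

/-- The secant locus `Σ_q(X)` for `q ∉ X`: the points `x` of `X` such that the line `⟨q, x⟩` is a
secant line, i.e. meets `X` in a scheme of length at least two.  Either it contains a second point
`y` of `X`, or it is tangent to `X` at `x`. -/
def secantLocus (X : Set (ℙ K (σ → K))) (q : ℙ K (σ → K)) : Set (ℙ K (σ → K)) :=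
  {x | x ∈ X ∧ ((∃ y ∈ X, x ≠ y ∧ q ∈ line x y) ∨ q ∈ tangentSpace X x)}

/-- The secant stratum `SL_s(X)`: the points `q` with `dim Σ_q(X) = s`, with the convention that
`dim Σ_q(X) = dim X` for `q ∈ X`. -/
def secantStratum (X : Set (ℙ K (σ → K))) (s : ℤ) : Set (ℙ K (σ → K)) :=
  {q | (q ∈ X ∧ HasDim X s) ∨ (q ∉ X ∧ HasDim (secantLocus X q) s)}

/-- `Y` is a smooth quadric surface: inside a three-dimensional projective linear subspace `ℙ(W)`
it is the zero locus of a quadratic form on `W` whose differential vanishes at no nonzero zero of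
the form (Jacobian criterion; `QuadraticMap.polar Q w` is the differential of `Q` at `w`). -/
def IsSmoothQuadricSurface (Y : Set (ℙ K (σ → K))) : Prop :=
  ∃ W : Submodule K (σ → K), Module.finrank K W = 4 ∧
    ∃ Q : QuadraticForm K W,
      (∀ w : W, w ≠ 0 → Q w = 0 → ∃ w' : W, QuadraticMap.polar Q w w' ≠ 0) ∧
      Y = {p | p.submodule ≤ W ∧ ∀ w : W, (w : σ → K) ∈ p.submodule → Q w = 0}

theorem segre_ne_zero {m n : ℕ} {u : Fin m → K} {v : Fin n → K} (hu : u ≠ 0) (hv : v ≠ 0) :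
    (fun ij : Fin m × Fin n => u ij.1 * v ij.2) ≠ 0 := by
  obtain ⟨i, hi⟩ := Function.ne_iff.mp hu
  obtain ⟨j, hj⟩ := Function.ne_iff.mp hv
  exact Function.ne_iff.mpr ⟨(i, j), mul_ne_zero hi hj⟩

/-- The Segre embedding `ℙ^a × ℙ^b → ℙ^N`, `N + 1 = (a + 1)(b + 1)`, which sends `([u], [v])` to
`[u_i v_j]`.  The homogeneous coordinates of `ℙ^N` are indexed by the pairs `(i, j)`. -/
def segreMap (K : Type*) [Field K] (a b : ℕ)
    (p : ℙ K (Fin (a + 1) → K) × ℙ K (Fin (b + 1) → K)) :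
    ℙ K (Fin (a + 1) × Fin (b + 1) → K) :=
  Projectivization.mk K (fun ij => p.1.rep ij.1 * p.2.rep ij.2)
    (segre_ne_zero p.1.rep_nonzero p.2.rep_nonzero)

/-- The Segre variety. -/
def segreVariety (K : Type*) [Field K] (a b : ℕ) : Set (ℙ K (Fin (a + 1) × Fin (b + 1) → K)) :=
  Set.range (segreMap K a b)

end SecantLoci

end

/-! Points of the ambient space are nonzero matrices up to scalars, and the Segre variety is the
locus of rank one. A sum of two rank one matrices has rank at most two, and this condition is closed
because it is given by the 3 × 3 minors; so `Sec(X)` is the locus of rank at most two. The tangent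
space at `[u ⊗ v]` consists of the matrices `u ⊗ v' + u' ⊗ v`, and every `u ⊗ v + u' ⊗ v'` is of
this form at `[u ⊗ v']` unless its rank drops; hence `Tan(X)` is the same locus.

If `q = u ⊗ v + u' ⊗ v'` has rank two, the planes `⟨u, u'⟩` and `⟨v, v'⟩` depend on `q` only. A
secant or tangent line through `q` therefore meets `X` inside `⟨u, u'⟩ ⊗ ⟨v, v'⟩`. Conversely, every
rank one point `x` there lies in the secant locus: in these bases `q` is the identity 2 × 2 matrix,
and the trace of `x` decides whether the line is tangent or meets `X` again
(`secantLocus_rankLeOne`). So the locus is the quadric `det = 0` in a `ℙ³`.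

Dimensions are computed as transcendence degrees (`ringKrullDim_vanishingIdeal`): each cone is the
image of a polynomial map, and explicit matrix entries, or contractions, form a transcendence basis.
The strata separate because `-1`, `2` and `a + b ≥ 3` are distinct. -/

noncomputable section

namespace SecantLoci

/-! ### Krull dimension and transcendence degree -/

section KrullDimension

/-- An injective integral extension preserves the Krull dimension. -/
theorem ringKrullDim_eq_of_isIntegral (R S : Type*) [CommRing R] [CommRing S] [Algebra R S]
    [Algebra.IsIntegral R S] [FaithfulSMul R S] : ringKrullDim S = ringKrullDim R := by
  apply le_antisymm
  · refine Order.krullDim_le_of_strictMono (PrimeSpectrum.comap (algebraMap R S)) ?_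
    intro I J hIJ
    -- Incomparability: distinct nested primes have distinct contractions.
    exact Ideal.IsIntegral.comap_lt_comap (I := I.asIdeal) (J := J.asIdeal) hIJ
  · refine iSup_le fun l => ?_
    -- Lying over gives a prime above the bottom of the chain; going up lifts the rest.
    obtain ⟨P, hP, hPo⟩ :=
      (inferInstance : Nonempty ((RelSeries.head l).asIdeal.primesOver S))
    obtain ⟨L, hL, -⟩ := Ideal.exists_ltSeries_of_hasGoingUp l P
    rw [← hL]
    exact Order.LTSeries.length_le_krullDim L

/-- The Krull dimension of a finitely generated domain over a field is the cardinality of any of its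
transcendence bases. -/
theorem ringKrullDim_of_isTranscendenceBasis {k R ι : Type*} [Field k] [CommRing R] [IsDomain R]
    [Algebra k R] [Algebra.FiniteType k R] [Finite ι] {x : ι → R}
    (hx : IsTranscendenceBasis k x) : ringKrullDim R = (Nat.card ι : ℕ) := by
  -- Noether normalization: `R` is integral over a polynomial ring in `s` variables, so both its
  -- Krull dimension and its transcendence degree equal `s`.
  obtain ⟨s, g, hinj, hint⟩ := exists_integral_inj_algHom_of_fg k R
  let _ : Algebra (MvPolynomial (Fin s) k) R := g.toRingHom.toAlgebra
  have : IsScalarTower k (MvPolynomial (Fin s) k) R :=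
    IsScalarTower.of_algebraMap_eq fun c => (g.commutes c).symm
  have : Algebra.IsIntegral (MvPolynomial (Fin s) k) R := ⟨hint⟩
  have : FaithfulSMul (MvPolynomial (Fin s) k) R :=
    (faithfulSMul_iff_algebraMap_injective _ _).mpr hinj
  have h1 := lift_trdeg_add_eq k (MvPolynomial (Fin s) k) R
  have h2 := hx.lift_cardinalMk_eq_trdeg
  have h3 : Nat.card ι = s := by
    rw [trdeg_eq_zero (R := MvPolynomial (Fin s) k), MvPolynomial.trdeg_of_isDomain] at h1
    simp only [Cardinal.mk_fin, Cardinal.lift_natCast, Cardinal.lift_zero, add_zero] at h1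
    have h4 := congrArg Cardinal.toNat h2
    have h5 := congrArg Cardinal.toNat h1
    simp only [Cardinal.toNat_lift, Cardinal.toNat_natCast] at h4 h5
    rw [h5, ← h4]
    rfl
  rw [ringKrullDim_eq_of_isIntegral (MvPolynomial (Fin s) k) R,
    MvPolynomial.ringKrullDim_of_isNoetherianRing, ringKrullDim_eq_zero_of_field, h3]
  simp

end KrullDimension

/-! ### Dimension of parametrized affine sets -/

section Parametrization

variable {K : Type*} [Field K] {σ : Type*}

theorem mem_vanishingIdeal_iff_eval {V : Set (σ → K)} {F : MvPolynomial σ K} :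
    F ∈ MvPolynomial.vanishingIdeal K V ↔ ∀ x ∈ V, MvPolynomial.eval x F = 0 := by
  simp [MvPolynomial.mem_vanishingIdeal_iff, MvPolynomial.aeval_eq_eval]

theorem eval_aeval {τ : Type*} (g : σ → MvPolynomial τ K) (y : τ → K) (F : MvPolynomial σ K) :
    MvPolynomial.eval y (MvPolynomial.aeval g F) =
      MvPolynomial.eval (fun i => MvPolynomial.eval y (g i)) F := by
  rw [← MvPolynomial.aeval_eq_eval, ← MvPolynomial.aeval_eq_eval,
    ← MvPolynomial.comp_aeval_apply]

/-- The vanishing ideal of the image of a polynomial map is prime. -/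
theorem isPrime_vanishingIdeal_range [Infinite K] {τ : Type*} (g : σ → MvPolynomial τ K) :
    (MvPolynomial.vanishingIdeal K
      (Set.range fun (y : τ → K) i => MvPolynomial.eval y (g i))).IsPrime := by
  have h : MvPolynomial.vanishingIdeal K
      (Set.range fun (y : τ → K) i => MvPolynomial.eval y (g i)) =
      RingHom.ker (MvPolynomial.aeval g : MvPolynomial σ K →ₐ[K] MvPolynomial τ K) := by
    ext F
    rw [mem_vanishingIdeal_iff_eval, RingHom.mem_ker, Set.forall_mem_range]
    constructor
    · intro h
      refine MvPolynomial.funext fun y => ?_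
      rw [eval_aeval, h y, map_zero]
    · intro h y
      rw [← eval_aeval, h, map_zero]
  rw [h]
  exact RingHom.ker_isPrime _

/-- An irreducible affine set `V` has dimension `#S` if some `#S` regular functions on it take
almost all values and determine the coordinates rationally. -/
theorem ringKrullDim_vanishingIdeal [Infinite K] [Finite σ] {S : Type*} [Finite S]
    {V : Set (σ → K)} (hV : (MvPolynomial.vanishingIdeal K V).IsPrime)
    (f : S → MvPolynomial σ K) (Δ : MvPolynomial S K) (hΔ : Δ ≠ 0)
    (hdense : ∀ c : S → K, MvPolynomial.eval c Δ ≠ 0 →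
      ∃ x ∈ V, ∀ s, MvPolynomial.eval x (f s) = c s)
    (halg : ∀ i, ∃ D P : MvPolynomial S K, D ≠ 0 ∧ ∀ x ∈ V,
      MvPolynomial.eval (fun s => MvPolynomial.eval x (f s)) D * x i =
        MvPolynomial.eval (fun s => MvPolynomial.eval x (f s)) P) :
    ringKrullDim (MvPolynomial σ K ⧸ MvPolynomial.vanishingIdeal K V) = (Nat.card S : ℕ) := by
  set I := MvPolynomial.vanishingIdeal K V with hI
  have : IsDomain (MvPolynomial σ K ⧸ I) := Ideal.Quotient.isDomain I
  let x : S → MvPolynomial σ K ⧸ I := fun s => Ideal.Quotient.mkₐ K I (f s)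
  have hx : ∀ p : MvPolynomial S K, MvPolynomial.aeval x p =
      Ideal.Quotient.mkₐ K I (MvPolynomial.aeval f p) := fun p => by
    rw [← MvPolynomial.comp_aeval_apply]
  have hind : AlgebraicIndependent K x := by
    rw [algebraicIndependent_iff]
    intro p hp
    rw [hx, Ideal.Quotient.mkₐ_eq_mk, Ideal.Quotient.eq_zero_iff_mem, mem_vanishingIdeal_iff_eval] at hp
    -- A relation `p` vanishes at all values attained, hence off the zeros of `Δ`; so `p * Δ`
    -- vanishes everywhere, and `K` is infinite.
    have h0 : p * Δ = 0 := by
      refine MvPolynomial.funext fun c => ?_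
      by_cases hc : MvPolynomial.eval c Δ = 0
      · simp [hc]
      · obtain ⟨y, hy, hyc⟩ := hdense c hc
        have := hp y hy
        rw [eval_aeval, funext hyc] at this
        simp [this]
    exact (mul_eq_zero.mp h0).resolve_right hΔ
  refine ringKrullDim_of_isTranscendenceBasis (k := K) (x := x) ?_
  rw [isTranscendenceBasis_iff_algebraicIndependent_isAlgebraic]
  refine ⟨hind, ?_⟩
  have hmem : ∀ p : MvPolynomial S K, MvPolynomial.aeval x p ∈ Algebra.adjoin K (Set.range x) := by
    intro p
    rw [Algebra.adjoin_range_eq_range_aeval]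
    exact ⟨p, rfl⟩
  have hX : ∀ i, IsAlgebraic (Algebra.adjoin K (Set.range x))
      (Ideal.Quotient.mkₐ K I (MvPolynomial.X i)) := by
    intro i
    obtain ⟨D, P, hD, hDP⟩ := halg i
    -- The coordinate is a root of the linear polynomial `D T - P`; its leading coefficient is
    -- nonzero by algebraic independence.
    refine ⟨Polynomial.C ⟨_, hmem D⟩ * Polynomial.X - Polynomial.C ⟨_, hmem P⟩, ?_, ?_⟩
    · intro h0
      have := congrArg (fun q => Polynomial.coeff q 1) h0
      simp only [Polynomial.coeff_sub, Polynomial.coeff_C_mul, Polynomial.coeff_X_one, mul_one,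
        Polynomial.coeff_C_succ, sub_zero, Polynomial.coeff_zero] at this
      exact hD (algebraicIndependent_iff.mp hind D (congrArg Subtype.val this))
    · simp only [map_sub, map_mul, Polynomial.aeval_C, Polynomial.aeval_X]
      change MvPolynomial.aeval x D * _ - MvPolynomial.aeval x P = 0
      rw [hx, hx, ← map_mul, ← map_sub, Ideal.Quotient.mkₐ_eq_mk, Ideal.Quotient.eq_zero_iff_mem,
        mem_vanishingIdeal_iff_eval]
      intro y hy
      rw [map_sub, map_mul, eval_aeval, eval_aeval, MvPolynomial.eval_X, hDP y hy, sub_self]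
  refine ⟨fun z => ?_⟩
  obtain ⟨F, rfl⟩ := Ideal.Quotient.mkₐ_surjective K I z
  induction F using MvPolynomial.induction_on with
  | C a =>
    have : Ideal.Quotient.mkₐ K I (MvPolynomial.C a) =
        algebraMap (Algebra.adjoin K (Set.range x)) _ (algebraMap K _ a) := rfl
    rw [this]
    exact isAlgebraic_algebraMap _
  | add p q hp hq => rw [map_add]; exact hp.add hq
  | mul_X p i hp => rw [map_mul]; exact hp.mul (hX i)

end Parametrization

/-! ### Matrices of rank at most one and two -/

section Tensor

variable {K : Type*} [Field K] {ι κ : Type*}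

/-- The rank one matrix `(u_i v_j)`. -/
def tensor (u : ι → K) (v : κ → K) : ι × κ → K := fun ij => u ij.1 * v ij.2

@[simp]
theorem tensor_apply (u : ι → K) (v : κ → K) (i : ι) (j : κ) : tensor u v (i, j) = u i * v j :=
  rfl

variable (K ι κ) in
/-- The matrices of rank at most one. -/
def rankLeOne : Set (ι × κ → K) := {x | ∃ u v, x = tensor u v}

variable (K ι κ) in
/-- The matrices of rank at most two. -/
def rankLeTwo : Set (ι × κ → K) :=
  {x | ∃ u u' v v', x = tensor u v + tensor u' v'}

theorem smul_tensor (c : K) (u : ι → K) (v : κ → K) : c • tensor u v = tensor (c • u) v := by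
  ext ij; simp [tensor, mul_assoc]

theorem tensor_zero (u : ι → K) : tensor u (0 : κ → K) = 0 := by ext ij; simp [tensor]

theorem zero_tensor (v : κ → K) : tensor (0 : ι → K) v = 0 := by ext ij; simp [tensor]

theorem rankLeOne_subset_rankLeTwo : rankLeOne K ι κ ⊆ rankLeTwo K ι κ := by
  rintro _ ⟨u, v, rfl⟩
  exact ⟨u, 0, v, 0, by rw [tensor_zero, add_zero]⟩

theorem smul_mem_rankLeOne (c : K) {x : ι × κ → K} (hx : x ∈ rankLeOne K ι κ) :
    c • x ∈ rankLeOne K ι κ := by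
  obtain ⟨u, v, rfl⟩ := hx
  exact ⟨c • u, v, smul_tensor c u v⟩

theorem smul_mem_rankLeTwo (c : K) {x : ι × κ → K} (hx : x ∈ rankLeTwo K ι κ) :
    c • x ∈ rankLeTwo K ι κ := by
  obtain ⟨u, u', v, v', rfl⟩ := hx
  exact ⟨c • u, c • u', v, v', by rw [smul_add, smul_tensor, smul_tensor]⟩

theorem mem_rankLeOne_of_minors {x : ι × κ → K}
    (h : ∀ i k j l, x (i, j) * x (k, l) - x (i, l) * x (k, j) = 0) : x ∈ rankLeOne K ι κ := by
  by_cases hx : x = 0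
  · exact ⟨0, 0, by rw [hx, tensor_zero]⟩
  · obtain ⟨⟨k, l⟩, hkl⟩ := Function.ne_iff.mp hx
    have hkl : x (k, l) ≠ 0 := hkl
    -- Every row is a multiple of row `k`, where the entry in column `l` is nonzero.
    refine ⟨fun i => x (i, l) / x (k, l), fun j => x (k, j), ?_⟩
    ext ⟨i, j⟩
    rw [tensor_apply]
    field_simp
    linear_combination h i k j l

/-- The determinant of a `3 × 3` submatrix. -/
def minorThree {R : Type*} [CommRing R] (x : ι × κ → R) (i k r : ι) (j l s : κ) : R :=
  x (i, j) * (x (k, l) * x (r, s) - x (k, s) * x (r, l)) -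
    x (i, l) * (x (k, j) * x (r, s) - x (k, s) * x (r, j)) +
    x (i, s) * (x (k, j) * x (r, l) - x (k, l) * x (r, j))

theorem minorThree_eq_zero {x : ι × κ → K} (hx : x ∈ rankLeTwo K ι κ) (i k r : ι) (j l s : κ) :
    minorThree x i k r j l s = 0 := by
  obtain ⟨u, u', v, v', rfl⟩ := hx
  simp only [minorThree, Pi.add_apply, tensor_apply]
  ring

theorem mem_rankLeTwo_of_minors {x : ι × κ → K}
    (h : ∀ i k r j l s, minorThree x i k r j l s = 0) : x ∈ rankLeTwo K ι κ := by
  by_cases h2 : ∀ i k j l, x (i, j) * x (k, l) - x (i, l) * x (k, j) = 0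
  · exact rankLeOne_subset_rankLeTwo (mem_rankLeOne_of_minors h2)
  · push Not at h2
    obtain ⟨i, k, j, l, hd⟩ := h2
    -- With a nonzero 2 × 2 minor, rows `i` and `k` span the row space; the coefficients of row `r`
    -- come from Cramer's rule in columns `j` and `l`.
    refine ⟨fun r => (x (r, j) * x (k, l) - x (r, l) * x (k, j)) /
        (x (i, j) * x (k, l) - x (i, l) * x (k, j)),
      fun r => (x (i, j) * x (r, l) - x (i, l) * x (r, j)) /
        (x (i, j) * x (k, l) - x (i, l) * x (k, j)),
      fun s => x (i, s), fun s => x (k, s), ?_⟩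
    ext ⟨r, s⟩
    rw [Pi.add_apply, tensor_apply, tensor_apply, div_mul_eq_mul_div, div_mul_eq_mul_div, ← add_div,
      eq_div_iff hd]
    have := h i k r j l s
    rw [minorThree] at this
    linear_combination this

/-- A linear relation between the left factors lowers the rank. -/
theorem linearIndependent_left {u u' : ι → K} {v v' : κ → K}
    (h : tensor u v + tensor u' v' ∉ rankLeOne K ι κ) : LinearIndependent K ![u, u'] := by
  rw [LinearIndependent.pair_iff]
  intro s t hst
  by_contra hne
  apply h
  have hst' : ∀ i, s * u i + t * u' i = 0 := fun i => by simpa using congrFun hst i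
  by_cases hs : s = 0
  · have ht : t ≠ 0 := fun ht => hne ⟨hs, ht⟩
    refine ⟨u, v, ?_⟩
    have hu' : u' = 0 := by
      ext i
      have := hst' i
      rw [hs, zero_mul, zero_add] at this
      exact (mul_eq_zero.mp this).resolve_left ht
    rw [hu', zero_tensor, add_zero]
  -- Here `u = -(t / s) u'`, so both terms share the left factor `u'`.
  · refine ⟨u', fun j => v' j - t / s * v j, ?_⟩
    ext ⟨i, j⟩
    rw [Pi.add_apply, tensor_apply, tensor_apply, tensor_apply]
    field_simp
    linear_combination v j * hst' i

/-- Transposition carries statements about left factors over to right factors. -/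
theorem swap_mem_rankLeOne {x : ι × κ → K} :
    x ∘ Prod.swap ∈ rankLeOne K κ ι ↔ x ∈ rankLeOne K ι κ := by
  constructor
  · rintro ⟨u, v, h⟩
    refine ⟨v, u, ?_⟩
    ext ⟨i, j⟩
    simpa [mul_comm] using congrFun h (j, i)
  · rintro ⟨u, v, rfl⟩
    refine ⟨v, u, ?_⟩
    ext ⟨i, j⟩
    simp [mul_comm]

theorem tensor_comp_swap (u : ι → K) (v : κ → K) : tensor u v ∘ Prod.swap = tensor v u := by
  ext ⟨i, j⟩
  simp [mul_comm]

theorem linearIndependent_right {u u' : ι → K} {v v' : κ → K}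
    (h : tensor u v + tensor u' v' ∉ rankLeOne K ι κ) : LinearIndependent K ![v, v'] := by
  rw [← swap_mem_rankLeOne] at h
  refine linearIndependent_left (u := v) (u' := v') (v := u) (v' := u') ?_
  rwa [← tensor_comp_swap u v, ← tensor_comp_swap u' v']

/-- A linearly independent finite family of vectors has a dual family of linear forms. -/
theorem exists_dual_family [Fintype ι] {r : Type*} [Finite r] [DecidableEq r] {u : r → ι → K}
    (hu : LinearIndependent K u) :
    ∃ A : r → ι → K, ∀ a b, ∑ i, A a i * u b i = if a = b then 1 else 0 := by
  classical
  have := Fintype.ofFinite r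
  obtain ⟨g, hg⟩ := LinearMap.exists_leftInverse_of_injective (Fintype.linearCombination K u)
    (LinearMap.ker_eq_bot.mpr hu.fintypeLinearCombination_injective)
  refine ⟨fun a i => g (Pi.single i 1) a, fun a b => ?_⟩
  have h1 : g (u b) = Pi.single b 1 := by
    have := LinearMap.congr_fun hg (Pi.single b 1)
    simpa [Fintype.linearCombination_apply_single] using this
  have h2 : u b = ∑ i, u b i • (Pi.single i 1 : ι → K) := by
    ext j
    simp [Finset.sum_apply, Pi.single_apply]
  have h3 := congrFun h1 a
  rw [h2, map_sum, Finset.sum_apply] at h3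
  simp only [map_smul, Pi.smul_apply, smul_eq_mul] at h3
  rw [Finset.sum_congr rfl fun i _ => mul_comm _ _, h3, Pi.single_apply]

/-- In two decompositions of a rank two matrix the left factors span the same space. -/
theorem exists_left_of_add_eq_add [Fintype κ] {u u' w w' : ι → K} {v v' z z' : κ → K}
    (hz : LinearIndependent K ![z, z'])
    (h : tensor u v + tensor u' v' = tensor w z + tensor w' z') :
    ∃ s t : K, w = s • u + t • u' := by
  obtain ⟨A, hA⟩ := exists_dual_family hz
  -- Contracting the second index with the form `A 0`, which is `1` on `z` and `0` on `z'`, leaves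
  -- only `w` on the right.
  refine ⟨∑ j, A 0 j * v j, ∑ j, A 0 j * v' j, ?_⟩
  ext i
  have h0 : ∑ j, A 0 j * z j = 1 := by simpa using hA 0 0
  have h1 : ∑ j, A 0 j * z' j = 0 := by simpa using hA 0 1
  have h2 : ∑ j, A 0 j * (u i * v j + u' i * v' j) = ∑ j, A 0 j * (w i * z j + w' i * z' j) :=
    Finset.sum_congr rfl fun j _ => by
      have := congrFun h (i, j)
      simp only [Pi.add_apply, tensor_apply] at this
      rw [this]
  have h3 : ∀ (p p' : K) (q q' : κ → K), ∑ j, A 0 j * (p * q j + p' * q' j) =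
      p * ∑ j, A 0 j * q j + p' * ∑ j, A 0 j * q' j := fun p p' q q' => by
    rw [Finset.mul_sum, Finset.mul_sum, ← Finset.sum_add_distrib]
    exact Finset.sum_congr rfl fun j _ => by ring
  rw [h3, h3, h0, h1] at h2
  simp only [Pi.add_apply, Pi.smul_apply, smul_eq_mul]
  linear_combination -h2

theorem exists_right_of_add_eq_add [Fintype ι] {u u' w w' : ι → K} {v v' z z' : κ → K}
    (hw : LinearIndependent K ![w, w'])
    (h : tensor u v + tensor u' v' = tensor w z + tensor w' z') :
    ∃ s t : K, z = s • v + t • v' := by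
  refine exists_left_of_add_eq_add (v := u) (v' := u') (w' := z') hw ?_
  have := congrArg (· ∘ Prod.swap) h
  simp only [← tensor_comp_swap u, ← tensor_comp_swap u', ← tensor_comp_swap w,
    ← tensor_comp_swap w']
  exact this

end Tensor

/-! ### Projective sets and their cones -/

section Cone

variable {K : Type*} [Field K] {σ : Type*}

/-- The set of points of projective space that are represented by the vectors in `C`. -/
def projSet (C : Set (σ → K)) : Set (ℙ K (σ → K)) := {p | p.rep ∈ C}

theorem mk_mem_projSet {C : Set (σ → K)} (hC : ∀ (c : K), ∀ x ∈ C, c • x ∈ C) {v : σ → K}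
    (hv : v ≠ 0) : Projectivization.mk K v hv ∈ projSet C ↔ v ∈ C := by
  obtain ⟨c, hc⟩ := Projectivization.exists_smul_eq_mk_rep K v hv
  rw [projSet, Set.mem_ofPred_eq, ← hc]
  constructor
  · intro h
    have := hC (↑c⁻¹ : K) _ h
    rwa [← Units.smul_def, inv_smul_smul] at this
  · exact hC c v

/-- Stability under scalars makes membership independent of the representative; `0 ∈ C` is needed
because `affineCone` always contains the origin. -/
theorem affineCone_projSet [Fintype σ] {C : Set (σ → K)} (hC : ∀ (c : K), ∀ x ∈ C, c • x ∈ C)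
    (h0 : 0 ∈ C) : affineCone (projSet C) = C := by
  ext v
  by_cases hv : v = 0
  · subst hv
    simp [affineCone, h0]
  · simp [affineCone, hv, mk_mem_projSet hC]

theorem rep_mem_affineCone [Fintype σ] {Y : Set (ℙ K (σ → K))} {p : ℙ K (σ → K)} (hp : p ∈ Y) :
    p.rep ∈ affineCone Y := fun hv => by rwa [Projectivization.mk_rep]

end Cone

/-! ### Differentials along polynomial curves -/

section Derivative

variable {K : Type*} [Field K] {σ : Type*}

theorem polynomial_eval_aeval (g : σ → Polynomial K) (t : K) (F : MvPolynomial σ K) :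
    (MvPolynomial.aeval g F).eval t = MvPolynomial.eval (fun i => (g i).eval t) F := by
  rw [← Polynomial.coe_aeval_eq_eval, MvPolynomial.comp_aeval_apply, MvPolynomial.aeval_eq_eval]

variable [Fintype σ]

theorem sum_mul_pderiv_X (p x : σ → K) (j : σ) :
    ∑ i, p i * MvPolynomial.eval x (MvPolynomial.pderiv i (MvPolynomial.X j)) = p j := by
  classical
  simp [MvPolynomial.pderiv_X, Pi.single_apply, apply_ite (MvPolynomial.eval x)]

theorem sum_mul_pderiv_mul (p x : σ → K) (F G : MvPolynomial σ K) :
    ∑ i, p i * MvPolynomial.eval x (MvPolynomial.pderiv i (F * G)) =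
      (∑ i, p i * MvPolynomial.eval x (MvPolynomial.pderiv i F)) * MvPolynomial.eval x G +
        MvPolynomial.eval x F * ∑ i, p i * MvPolynomial.eval x (MvPolynomial.pderiv i G) := by
  rw [Finset.sum_mul, Finset.mul_sum, ← Finset.sum_add_distrib]
  refine Finset.sum_congr rfl fun i _ => ?_
  simp only [Derivation.leibniz, smul_eq_mul, map_add, map_mul]
  ring

/-- The chain rule for a polynomial along a polynomial curve. -/
theorem eval_derivative_aeval (g : σ → Polynomial K) (t : K) (F : MvPolynomial σ K) :
    (Polynomial.derivative (MvPolynomial.aeval g F)).eval t =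
      ∑ i, (Polynomial.derivative (g i)).eval t *
        MvPolynomial.eval (fun i => (g i).eval t) (MvPolynomial.pderiv i F) := by
  induction F using MvPolynomial.induction_on with
  | C a => simp
  | add p q hp hq =>
    simp only [map_add, Polynomial.eval_add, hp, hq, mul_add, Finset.sum_add_distrib]
  | mul_X p j hp =>
    rw [sum_mul_pderiv_mul, sum_mul_pderiv_X, map_mul, Polynomial.derivative_mul,
      Polynomial.eval_add, Polynomial.eval_mul, Polynomial.eval_mul, hp, polynomial_eval_aeval,
      polynomial_eval_aeval,
      MvPolynomial.aeval_X, MvPolynomial.eval_X]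

end Derivative

/-! ### Tangent, secant varieties and secant loci -/

section RankOne

variable {K : Type*} [Field K] {ι κ : Type*}

theorem smul_mem_rankLeOne' (c : K) : ∀ x ∈ rankLeOne K ι κ, c • x ∈ rankLeOne K ι κ :=
  fun _ hx => smul_mem_rankLeOne c hx

theorem smul_mem_rankLeTwo' (c : K) : ∀ x ∈ rankLeTwo K ι κ, c • x ∈ rankLeTwo K ι κ :=
  fun _ hx => smul_mem_rankLeTwo c hx

theorem zero_mem_rankLeOne : 0 ∈ rankLeOne K ι κ := ⟨0, 0, by rw [tensor_zero]⟩

theorem zero_mem_rankLeTwo : 0 ∈ rankLeTwo K ι κ :=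
  rankLeOne_subset_rankLeTwo zero_mem_rankLeOne

theorem segreVariety_eq (a b : ℕ) :
    segreVariety K a b = projSet (rankLeOne K (Fin (a + 1)) (Fin (b + 1))) := by
  ext p
  constructor
  · rintro ⟨⟨x, y⟩, rfl⟩
    rw [segreMap, mk_mem_projSet smul_mem_rankLeOne']
    exact ⟨x.rep, y.rep, rfl⟩
  · rintro ⟨u, v, huv⟩
    have hu : u ≠ 0 := by
      rintro rfl
      exact p.rep_nonzero (huv.trans (zero_tensor v))
    have hv : v ≠ 0 := by
      rintro rfl
      exact p.rep_nonzero (huv.trans (tensor_zero u))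
    refine ⟨(Projectivization.mk K u hu, Projectivization.mk K v hv), ?_⟩
    obtain ⟨c, hc⟩ := Projectivization.exists_smul_eq_mk_rep K u hu
    obtain ⟨d, hd⟩ := Projectivization.exists_smul_eq_mk_rep K v hv
    conv_rhs => rw [← p.mk_rep]
    rw [segreMap, Projectivization.mk_eq_mk_iff']
    refine ⟨c * d, ?_⟩
    rw [huv, ← hc, ← hd]
    ext ⟨i, j⟩
    simp only [Pi.smul_apply, tensor_apply, smul_eq_mul, Units.smul_def]
    ring

/-- If `v + w` has rank at least two for rank one matrices `v` and `w`, then `[v + w]` lies on the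
line through the distinct points `[v]` and `[w]`. -/
theorem exists_ne_mem_line {v w : ι × κ → K} (hv : v ∈ rankLeOne K ι κ) (hw : w ∈ rankLeOne K ι κ)
    (h : v + w ∉ rankLeOne K ι κ) :
    ∃ (hv0 : v ≠ 0) (hw0 : w ≠ 0), Projectivization.mk K v hv0 ≠ Projectivization.mk K w hw0 := by
  refine ⟨?_, ?_, ?_⟩
  · rintro rfl
    exact h (by rwa [zero_add])
  · rintro rfl
    exact h (by rwa [add_zero])
  · rw [Ne, Projectivization.mk_eq_mk_iff']
    rintro ⟨c, rfl⟩
    refine h ?_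
    have : c • w + w = (c + 1) • w := by rw [add_smul, one_smul]
    rw [this]
    exact smul_mem_rankLeOne _ hw

variable [Fintype ι] [Fintype κ]

theorem homogeneousIdeal_rankLeOne :
    homogeneousIdeal (projSet (rankLeOne K ι κ)) =
      MvPolynomial.vanishingIdeal K (rankLeOne K ι κ) := by
  rw [homogeneousIdeal, affineCone_projSet smul_mem_rankLeOne' zero_mem_rankLeOne]

/-- The embedded tangent space of the Segre variety at `[u ⊗ v]`. -/
theorem mem_tangentSpace_iff [Infinite K] {x p : ℙ K (ι × κ → K)} {u : ι → K} {v : κ → K}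
    (hx : x.rep = tensor u v) :
    p ∈ tangentSpace (projSet (rankLeOne K ι κ)) x ↔
      ∃ u' v', p.rep = tensor u v' + tensor u' v := by
  have hx0 : tensor u v ≠ 0 := hx ▸ x.rep_nonzero
  rw [tangentSpace, Set.mem_ofPred_eq, homogeneousIdeal_rankLeOne, hx]
  constructor
  · intro h
    obtain ⟨⟨k, l⟩, hkl⟩ := Function.ne_iff.mp hx0
    have hkl : u k * v l ≠ 0 := hkl
    have hk : u k ≠ 0 := left_ne_zero_of_mul hkl
    have hl : v l ≠ 0 := right_ne_zero_of_mul hkl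
    -- Setting the differential at `u ⊗ v` of the minor on rows `i, k` and columns `j, l` to zero
    -- and solving for the entry `(i, j)` of `p` gives these factors.
    refine ⟨fun i => (p.rep (i, l) - u i * p.rep (k, l) / u k) / v l,
      fun j => p.rep (k, j) / u k, ?_⟩
    ext ⟨i, j⟩
    have hF := h (MvPolynomial.X (i, j) * MvPolynomial.X (k, l) -
      MvPolynomial.X (i, l) * MvPolynomial.X (k, j)) (by
        rw [mem_vanishingIdeal_iff_eval]
        rintro _ ⟨w, z, rfl⟩
        simp only [map_sub, map_mul, MvPolynomial.eval_X, tensor_apply]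
        ring)
    simp only [map_sub, mul_sub, Finset.sum_sub_distrib] at hF
    rw [sum_mul_pderiv_mul, sum_mul_pderiv_mul] at hF
    simp only [sum_mul_pderiv_X, MvPolynomial.eval_X, tensor_apply] at hF
    rw [Pi.add_apply, tensor_apply, tensor_apply]
    field_simp
    linear_combination hF
  · rintro ⟨u', v', hp⟩ F hF
    rw [mem_vanishingIdeal_iff_eval] at hF
    -- The curve `(u + t u') ⊗ (v + t v')` stays in the cone and has velocity `p` at `t = 0`.
    let g : ι × κ → Polynomial K := fun ij =>
      (Polynomial.C (u ij.1) + Polynomial.C (u' ij.1) * Polynomial.X) *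
        (Polynomial.C (v ij.2) + Polynomial.C (v' ij.2) * Polynomial.X)
    have h0 : MvPolynomial.aeval g F = 0 := by
      refine Polynomial.funext fun t => ?_
      rw [polynomial_eval_aeval, Polynomial.eval_zero]
      refine hF _ ⟨fun i => u i + u' i * t, fun j => v j + v' j * t, ?_⟩
      ext ⟨i, j⟩
      simp [g]
    have h1 := eval_derivative_aeval g 0 F
    rw [h0, Polynomial.derivative_zero, Polynomial.eval_zero] at h1
    have hg0 : (fun i => (g i).eval 0) = tensor u v := by
      ext ⟨i, j⟩
      simp [g]
    have hg1 : ∀ i, (Polynomial.derivative (g i)).eval 0 = p.rep i := by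
      rintro ⟨i, j⟩
      rw [hp]
      simp only [g, Polynomial.derivative_mul]
      simp
      ring
    rw [h1, hg0]
    exact Finset.sum_congr rfl fun i _ => by rw [hg1]

/-- A rank two matrix `u ⊗ v + u' ⊗ v'` is tangent at `[u ⊗ v']`, which shares its left factor with
one summand and its right factor with the other. -/
theorem tangentVariety_rankLeOne [Infinite K] :
    tangentVariety (projSet (rankLeOne K ι κ)) = projSet (rankLeTwo K ι κ) := by
  ext p
  constructor
  · rintro ⟨x, ⟨u, v, hx⟩, hp⟩
    obtain ⟨u', v', h⟩ := (mem_tangentSpace_iff hx).mp hp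
    exact ⟨u, u', v', v, h⟩
  · intro hp
    by_cases h1 : p.rep ∈ rankLeOne K ι κ
    · obtain ⟨u, v, h⟩ := h1
      refine ⟨p, ⟨u, v, h⟩, (mem_tangentSpace_iff h).mpr ⟨0, v, ?_⟩⟩
      rw [h, zero_tensor, add_zero]
    · obtain ⟨u, u', v, v', h⟩ := hp
      rw [h] at h1
      have hu := (linearIndependent_left h1).ne_zero 0
      have hv := (linearIndependent_right h1).ne_zero 1
      have h0 : tensor u v' ≠ 0 := by
        obtain ⟨i, hi⟩ := Function.ne_iff.mp hu
        obtain ⟨j, hj⟩ := Function.ne_iff.mp hv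
        exact Function.ne_iff.mpr ⟨(i, j), mul_ne_zero hi hj⟩
      obtain ⟨c, hc⟩ := Projectivization.exists_smul_eq_mk_rep K _ h0
      have hc' : (Projectivization.mk K _ h0).rep = tensor ((c : K) • u) v' := by
        rw [← hc, ← smul_tensor, Units.smul_def]
      refine ⟨Projectivization.mk K _ h0, ⟨_, _, hc'⟩, (mem_tangentSpace_iff hc').mpr
        ⟨u', (c : K)⁻¹ • v, ?_⟩⟩
      rw [h]
      congr 1
      ext ⟨i, j⟩
      simp only [tensor_apply, Pi.smul_apply, smul_eq_mul]
      field_simp [c.ne_zero]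

theorem mem_line_mk_iff {σ : Type*} [Fintype σ] {v w : σ → K} (hv : v ≠ 0) (hw : w ≠ 0)
    {p : ℙ K (σ → K)} :
    p ∈ line (Projectivization.mk K v hv) (Projectivization.mk K w hw) ↔
      ∃ c d : K, p.rep = c • v + d • w := by
  rw [line, Set.mem_ofPred_eq, p.submodule_eq, Projectivization.submodule_mk,
    Projectivization.submodule_mk, Submodule.span_singleton_le_iff_mem, Submodule.mem_sup]
  simp only [Submodule.mem_span_singleton]
  constructor
  · rintro ⟨_, ⟨c, rfl⟩, _, ⟨d, rfl⟩, h⟩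
    exact ⟨c, d, h.symm⟩
  · rintro ⟨c, d, h⟩
    exact ⟨_, ⟨c, rfl⟩, _, ⟨d, rfl⟩, h.symm⟩

theorem mem_line_iff {σ : Type*} [Fintype σ] {x y p : ℙ K (σ → K)} :
    p ∈ line x y ↔ ∃ c d : K, p.rep = c • x.rep + d • y.rep := by
  rw [← mem_line_mk_iff x.rep_nonzero y.rep_nonzero, Projectivization.mk_rep,
    Projectivization.mk_rep]

theorem rep_mem_rankLeTwo_of_mem_line {x y p : ℙ K (ι × κ → K)}
    (hx : x ∈ projSet (rankLeOne K ι κ)) (hy : y ∈ projSet (rankLeOne K ι κ)) (hp : p ∈ line x y) :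
    p.rep ∈ rankLeTwo K ι κ := by
  obtain ⟨c, d, h⟩ := mem_line_iff.mp hp
  obtain ⟨u, v, hx⟩ := hx
  obtain ⟨u', v', hy⟩ := hy
  exact ⟨c • u, d • u', v, v', by rw [h, hx, hy, smul_tensor, smul_tensor]⟩

/-- The points on the lines through two distinct points of the Segre variety. -/
theorem secantLines_eq [Nonempty ι] [Nontrivial κ] :
    {p | ∃ x ∈ projSet (rankLeOne K ι κ), ∃ y ∈ projSet (rankLeOne K ι κ),
      x ≠ y ∧ p ∈ line x y} = projSet (rankLeTwo K ι κ) := by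
  classical
  ext p
  constructor
  · rintro ⟨x, hx, y, hy, -, hp⟩
    exact rep_mem_rankLeTwo_of_mem_line hx hy hp
  · intro hp
    by_cases h1 : p.rep ∈ rankLeOne K ι κ
    -- A point of `X` lies on the line joining it to any other point of `X`; two matrix units in one
    -- row ensure that another point exists.
    · obtain ⟨y, hy, hyp⟩ : ∃ y ∈ projSet (rankLeOne K ι κ), p ≠ y := by
        obtain ⟨i⟩ := ‹Nonempty ι›
        obtain ⟨j, l, hjl⟩ := exists_pair_ne κ
        have hne : ∀ j : κ, tensor (Pi.single i 1 : ι → K) (Pi.single j 1 : κ → K) ≠ 0 := fun j =>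
          Function.ne_iff.mpr ⟨(i, j), by simp⟩
        by_contra! hall
        have h1 := hall (Projectivization.mk K _ (hne j))
          ((mk_mem_projSet smul_mem_rankLeOne' _).mpr ⟨_, _, rfl⟩)
        have h2 := hall (Projectivization.mk K _ (hne l))
          ((mk_mem_projSet smul_mem_rankLeOne' _).mpr ⟨_, _, rfl⟩)
        rw [h1, Projectivization.mk_eq_mk_iff'] at h2
        obtain ⟨c, hc⟩ := h2
        simpa [hjl] using congrFun hc (i, j)
      exact ⟨p, h1, y, hy, hyp, mem_line_iff.mpr ⟨1, 0, by simp⟩⟩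
    · obtain ⟨u, u', v, v', h⟩ := hp
      rw [h] at h1
      obtain ⟨hv0, hw0, hne⟩ := exists_ne_mem_line ⟨u, v, rfl⟩ ⟨u', v', rfl⟩ h1
      exact ⟨_, (mk_mem_projSet smul_mem_rankLeOne' _).mpr ⟨_, _, rfl⟩, _,
        (mk_mem_projSet smul_mem_rankLeOne' _).mpr ⟨_, _, rfl⟩, hne,
        (mem_line_mk_iff hv0 hw0).mpr ⟨1, 1, by rw [one_smul, one_smul, h]⟩⟩

theorem secantVariety_rankLeOne [Nonempty ι] [Nontrivial κ] :
    secantVariety (projSet (rankLeOne K ι κ)) = projSet (rankLeTwo K ι κ) := by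
  rw [secantVariety, secantLines_eq]
  ext p
  constructor
  · intro hp
    refine mem_rankLeTwo_of_minors fun i k r j l s => ?_
    have := hp (minorThree MvPolynomial.X i k r j l s) (by
      rw [homogeneousIdeal, affineCone_projSet smul_mem_rankLeTwo' zero_mem_rankLeTwo,
        mem_vanishingIdeal_iff_eval]
      intro x hx
      have := minorThree_eq_zero hx i k r j l s
      simpa [minorThree] using this)
    simpa [minorThree] using this
  · intro hp F hF
    exact mem_vanishingIdeal_iff_eval.mp hF _ (rep_mem_affineCone hp)

/-- The rank one matrices in the tensor product of `⟨u, u'⟩` and `⟨v, v'⟩`. -/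
def tensorCone (u u' : ι → K) (v v' : κ → K) : Set (ι × κ → K) :=
  {x | ∃ s s' t t' : K, x = tensor (s • u + s' • u') (t • v + t' • v')}

theorem secantLocus_eq_empty [Infinite K] {q : ℙ K (ι × κ → K)} (hq : q.rep ∉ rankLeTwo K ι κ) :
    secantLocus (projSet (rankLeOne K ι κ)) q = ∅ := by
  rw [Set.eq_empty_iff_forall_notMem]
  rintro x ⟨hx, ⟨y, hy, -, hxy⟩ | h⟩
  · exact hq (rep_mem_rankLeTwo_of_mem_line hx hy hxy)
  · have : q ∈ tangentVariety (projSet (rankLeOne K ι κ)) := ⟨x, hx, h⟩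
    rw [tangentVariety_rankLeOne] at this
    exact hq this

/-- Any line that makes `x` a point of the locus writes `q` as a sum of two rank one matrices whose
factors include those of `x` up to scalars; uniqueness of the row and column spaces places `x` in
the cone. The converse is a computation with 2 × 2 matrices. -/
theorem secantLocus_rankLeOne [Infinite K] {q : ℙ K (ι × κ → K)} {u u' : ι → K} {v v' : κ → K}
    (hq : q.rep = tensor u v + tensor u' v') (hq1 : q.rep ∉ rankLeOne K ι κ) :
    secantLocus (projSet (rankLeOne K ι κ)) q = projSet (tensorCone u u' v v') := by
  ext x
  constructor
  · rintro ⟨⟨w, z, hx⟩, ⟨y, ⟨w', z', hy⟩, -, hxy⟩ | h⟩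
    · obtain ⟨c, d, h⟩ := mem_line_iff.mp hxy
      rw [hx, hy, smul_tensor, smul_tensor] at h
      rw [h] at hq1
      have hl := linearIndependent_left hq1
      have hr := linearIndependent_right hq1
      rw [hq] at h
      obtain ⟨s, s', hs⟩ := exists_left_of_add_eq_add hr h
      obtain ⟨t, t', ht⟩ := exists_right_of_add_eq_add hl h
      have hc : c ≠ 0 := by
        rintro rfl
        exact hl.ne_zero 0 (by simp)
      refine ⟨c⁻¹ * s, c⁻¹ * s', t, t', ?_⟩
      rw [hx, ← ht, mul_smul, mul_smul, ← smul_add, ← hs, inv_smul_smul₀ hc]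
    · obtain ⟨w', z', h⟩ := (mem_tangentSpace_iff hx).mp h
      rw [h] at hq1
      have hl := linearIndependent_left hq1
      have hr := linearIndependent_right hq1
      rw [hq] at h
      obtain ⟨s, s', hs⟩ := exists_left_of_add_eq_add hr h
      rw [add_comm (tensor w z')] at h hq1
      obtain ⟨t, t', ht⟩ := exists_right_of_add_eq_add (linearIndependent_left hq1) h
      exact ⟨s, s', t, t', by rw [hx, hs, ht]⟩
  · rintro ⟨s, s', t, t', hx⟩
    refine ⟨⟨_, _, hx⟩, ?_⟩
    -- In the given bases `q` is the identity and `x` the matrix `(s, s') ⊗ (t, t')`, with this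
    -- trace. Since `det (q - c x) = 1 - c tr x`, the line meets `X` again exactly when the trace is
    -- nonzero.
    by_cases he : s * t + s' * t' = 0
    · right
      rw [mem_tangentSpace_iff hx, hq]
      have hs : s ≠ 0 ∨ s' ≠ 0 := by
        by_contra! hs
        exact x.rep_nonzero (by rw [hx, hs.1, hs.2, zero_smul, zero_smul, add_zero, zero_tensor])
      have ht : t ≠ 0 ∨ t' ≠ 0 := by
        by_contra! ht
        exact x.rep_nonzero (by rw [hx, ht.1, ht.2, zero_smul, zero_smul, add_zero, tensor_zero])
      by_cases hs0 : s = 0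
      · have hs' := hs.resolve_left (not_not.mpr hs0)
        have ht' : t' = 0 := by simpa [hs0, hs'] using he
        have ht0 := ht.resolve_right (not_not.mpr ht')
        refine ⟨t⁻¹ • u, s'⁻¹ • v', ?_⟩
        ext ⟨i, j⟩
        simp only [Pi.add_apply, tensor_apply, Pi.smul_apply, smul_eq_mul, hs0, ht']
        field_simp
        ring
      · have ht' : t' ≠ 0 := by
          intro ht'
          have : t = 0 := by simpa [ht', hs0] using he
          exact ht.elim (fun h => h this) (fun h => h ht')
        -- The unwanted term `u' ⊗ v` has coefficient `s' / s + t / t'`, zero by `he`.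
        refine ⟨t'⁻¹ • u', s⁻¹ • v, ?_⟩
        ext ⟨i, j⟩
        simp only [Pi.add_apply, tensor_apply, Pi.smul_apply, smul_eq_mul]
        field_simp
        linear_combination (-(u' i * v j)) * he
    · left
      set e := s * t + s' * t'
      -- The second summand is the adjugate of `x`: a 2 × 2 matrix and its adjugate add up to the
      -- trace times the identity.
      have hsum : q.rep = e⁻¹ • x.rep +
          e⁻¹ • tensor (t' • u + (-t) • u') (s' • v + (-s) • v') := by
        rw [hq, hx, ← smul_add]
        rw [eq_inv_smul_iff₀ he]
        ext ⟨i, j⟩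
        simp only [Pi.add_apply, tensor_apply, Pi.smul_apply, smul_eq_mul, e]
        ring
      rw [hsum, ← smul_add] at hq1
      have hq2 : x.rep + tensor (t' • u + (-t) • u') (s' • v + (-s) • v') ∉ rankLeOne K ι κ :=
        fun h => hq1 (smul_mem_rankLeOne _ h)
      obtain ⟨hx0, hy0, hne⟩ := exists_ne_mem_line ⟨_, _, hx⟩ ⟨_, _, rfl⟩ hq2
      refine ⟨Projectivization.mk K _ hy0,
        (mk_mem_projSet smul_mem_rankLeOne' _).mpr ⟨_, _, rfl⟩, ?_, ?_⟩
      · rwa [x.mk_rep] at hne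
      · have := (mem_line_mk_iff hx0 hy0).mpr ⟨_, _, hsum⟩
        rwa [x.mk_rep] at this

end RankOne

/-! ### The determinantal quadric surface -/

section Quadric

variable {K : Type*} [Field K] {ι κ : Type*}

theorem linearIndependent_tensor {u u' : ι → K} {v v' : κ → K}
    (hu : LinearIndependent K ![u, u']) (hv : LinearIndependent K ![v, v']) :
    LinearIndependent K fun rs : Fin 2 × Fin 2 => tensor (![u, u'] rs.1) (![v, v'] rs.2) := by
  rw [Fintype.linearIndependent_iff]
  intro c hc
  rw [LinearIndependent.pair_iff] at hu hv
  have h : ∀ i, c (0, 0) * u i + c (1, 0) * u' i = 0 ∧ c (0, 1) * u i + c (1, 1) * u' i = 0 := by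
    intro i
    apply hv
    ext j
    have := congrFun hc (i, j)
    simp only [Fintype.sum_prod_type, Fin.sum_univ_two, Pi.add_apply, Pi.smul_apply,
      tensor_apply, smul_eq_mul, Matrix.cons_val_zero, Matrix.cons_val_one, Pi.zero_apply] at this ⊢
    linear_combination this
  have h0 := hu (c (0, 0)) (c (1, 0)) (funext fun i => (h i).1)
  have h1 := hu (c (0, 1)) (c (1, 1)) (funext fun i => (h i).2)
  rintro ⟨r, s⟩
  fin_cases r <;> fin_cases s
  exacts [h0.1, h1.1, h0.2, h1.2]

variable (K) in
/-- The determinant of `2 × 2` matrices as a quadratic form. -/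
def detForm : QuadraticForm K (Fin 2 × Fin 2 → K) :=
  QuadraticMap.linMulLin (LinearMap.proj (0, 0)) (LinearMap.proj (1, 1)) -
    QuadraticMap.linMulLin (LinearMap.proj (0, 1)) (LinearMap.proj (1, 0))

theorem detForm_apply (c : Fin 2 × Fin 2 → K) :
    detForm K c = c (0, 0) * c (1, 1) - c (0, 1) * c (1, 0) := rfl

/-- Polarizing against the four matrix units reads off the entries of `c` up to sign. -/
theorem exists_polar_detForm_ne_zero {c : Fin 2 × Fin 2 → K} (hc : c ≠ 0) :
    ∃ c', QuadraticMap.polar (detForm K) c c' ≠ 0 := by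
  by_contra! h
  apply hc
  ext ⟨r, s⟩
  have h00 := h (Pi.single (0, 0) 1)
  have h01 := h (Pi.single (0, 1) 1)
  have h10 := h (Pi.single (1, 0) 1)
  have h11 := h (Pi.single (1, 1) 1)
  simp only [QuadraticMap.polar, detForm_apply, Pi.add_apply, Pi.single_apply, Prod.mk.injEq,
    zero_ne_one, one_ne_zero, and_true, and_false, if_true, if_false] at h00 h01 h10 h11
  fin_cases r <;> fin_cases s
  · change c (0, 0) = 0
    linear_combination h11
  · change c (0, 1) = 0
    linear_combination -h10
  · change c (1, 0) = 0
    linear_combination -h01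
  · change c (1, 1) = 0
    linear_combination h00

theorem detForm_eq_zero_iff {c : Fin 2 × Fin 2 → K} :
    detForm K c = 0 ↔ c ∈ rankLeOne K (Fin 2) (Fin 2) := by
  rw [detForm_apply]
  constructor
  · intro h
    refine mem_rankLeOne_of_minors fun i k j l => ?_
    fin_cases i <;> fin_cases k <;> fin_cases j <;> fin_cases l <;>
      simp only [Fin.zero_eta, Fin.mk_one, Fin.isValue] <;>
      first
      | ring1
      | linear_combination h
      | linear_combination -h
  · rintro ⟨u, v, rfl⟩
    simp only [tensor_apply]
    ring

/-- The four tensors of basis vectors identify their span with the 2 × 2 matrices; this matches rank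
one tensors and carries the determinant over to the span. -/
theorem isSmoothQuadricSurface_tensorCone [Fintype ι] [Fintype κ] {u u' : ι → K} {v v' : κ → K}
    (hu : LinearIndependent K ![u, u']) (hv : LinearIndependent K ![v, v']) :
    IsSmoothQuadricSurface (projSet (tensorCone u u' v v')) := by
  let T := Fintype.linearCombination K
    fun rs : Fin 2 × Fin 2 => tensor (![u, u'] rs.1) (![v, v'] rs.2)
  have hT : Function.Injective T :=
    (linearIndependent_tensor hu hv).fintypeLinearCombination_injective
  let e := LinearEquiv.ofInjective T hT
  have he : ∀ c, (e c : ι × κ → K) = T c := fun c => rfl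
  have hTt : ∀ s t : Fin 2 → K, T (tensor s t) =
      tensor (s 0 • u + s 1 • u') (t 0 • v + t 1 • v') := by
    intro s t
    ext ⟨i, j⟩
    simp only [T, Fintype.linearCombination_apply, Fintype.sum_prod_type, Fin.sum_univ_two,
      Pi.add_apply, Pi.smul_apply, tensor_apply, smul_eq_mul, Matrix.cons_val_zero,
      Matrix.cons_val_one]
    ring
  refine ⟨LinearMap.range T, ?_, (detForm K).comp e.symm.toLinearMap, ?_, ?_⟩
  · rw [← e.finrank_eq]
    simp
  · intro w hw _
    obtain ⟨c', hc'⟩ := exists_polar_detForm_ne_zero (K := K) (c := e.symm w) (by simpa using hw)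
    refine ⟨e c', ?_⟩
    simpa [QuadraticMap.polar] using hc'
  · ext p
    simp only [Set.mem_ofPred_eq]
    rw [p.submodule_eq, Submodule.span_singleton_le_iff_mem]
    constructor
    · rintro ⟨s, s', t, t', hp⟩
      have hp : p.rep = T (tensor ![s, s'] ![t, t']) := by rw [hTt, hp]; rfl
      refine ⟨⟨_, hp.symm⟩, fun w hw => ?_⟩
      obtain ⟨a, ha⟩ := Submodule.mem_span_singleton.mp hw
      have hw : w = e (a • tensor ![s, s'] ![t, t']) :=
        Subtype.ext (by rw [he, map_smul, ← hp, ha])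
      rw [hw, QuadraticMap.comp_apply]
      simp only [LinearEquiv.coe_coe, LinearEquiv.symm_apply_apply]
      exact detForm_eq_zero_iff.mpr (smul_mem_rankLeOne _ ⟨_, _, rfl⟩)
    · rintro ⟨⟨c, hc⟩, h⟩
      have h := h (e c) (by rw [he, hc]; exact Submodule.mem_span_singleton_self _)
      rw [QuadraticMap.comp_apply] at h
      simp only [LinearEquiv.coe_coe, LinearEquiv.symm_apply_apply] at h
      obtain ⟨s, t, rfl⟩ := detForm_eq_zero_iff.mp h
      exact ⟨s 0, s 1, t 0, t 1, by rw [← hTt, hc]⟩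

end Quadric

/-! ### Dimensions of the cones -/

section Dimension

variable {K : Type*} [Field K]

theorem hasDim_projSet {σ : Type*} [Fintype σ] {C : Set (σ → K)}
    (hC : ∀ (c : K), ∀ x ∈ C, c • x ∈ C) (h0 : 0 ∈ C) {n : ℕ}
    (h : ringKrullDim (MvPolynomial σ K ⧸ MvPolynomial.vanishingIdeal K C) = (n : ℕ)) :
    HasDim (projSet C) ((n : ℤ) - 1) := by
  refine ⟨n, ?_, rfl⟩
  rw [homogeneousIdeal, affineCone_projSet hC h0, h]

theorem HasDim.unique {σ : Type*} [Fintype σ] {Y : Set (ℙ K (σ → K))} {d e : ℤ} (hd : HasDim Y d)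
    (he : HasDim Y e) : d = e := by
  obtain ⟨n, hn, rfl⟩ := hd
  obtain ⟨m, hm, rfl⟩ := he
  have h : ((n : ℕ∞) : WithBot ℕ∞) = (m : ℕ∞) := by exact_mod_cast hn.symm.trans hm
  have : n = m := by exact_mod_cast h
  rw [this]

theorem hasDim_empty [Infinite K] {σ : Type*} [Fintype σ] :
    HasDim (∅ : Set (ℙ K (σ → K))) (-1) := by
  have h : (∅ : Set (ℙ K (σ → K))) = projSet {0} := by
    ext p
    simp [projSet, p.rep_nonzero]
  -- The cone over the empty set is the origin, the image of a map from a point; its coordinate ring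
  -- has dimension `0`, which gives `-1`.
  have hr : ({0} : Set (σ → K)) = Set.range fun (y : Empty → K) i =>
      MvPolynomial.eval y ((0 : σ → MvPolynomial Empty K) i) := by
    ext x
    simp only [Set.mem_singleton_iff, Set.mem_range, Pi.zero_apply, map_zero]
    exact ⟨fun h => ⟨Empty.elim, h.symm⟩, fun ⟨_, h⟩ => h.symm⟩
  rw [h]
  refine hasDim_projSet (C := {(0 : σ → K)}) (n := 0) (fun c x hx => ?_) rfl ?_
  · rw [Set.mem_singleton_iff] at hx ⊢
    rw [hx, smul_zero]
  have hp : (MvPolynomial.vanishingIdeal K ({0} : Set (σ → K))).IsPrime := by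
    rw [hr]
    exact isPrime_vanishingIdeal_range _
  have := ringKrullDim_vanishingIdeal hp (S := Empty) Empty.elim 1 one_ne_zero
    (fun c _ => ⟨0, rfl, fun s => s.elim⟩)
    (fun i => ⟨1, 0, one_ne_zero, by simp⟩)
  simpa using this

variable {ι κ : Type*}

theorem sum_dual_mul_sum [Fintype ι] {k : ℕ} {w A : Fin k → ι → K}
    (hA : ∀ a b, ∑ i, A a i * w b i = if a = b then 1 else 0) (s : Fin k → K) (r : Fin k) :
    ∑ i, A r i * (∑ r, s r • w r) i = s r := by
  simp only [Finset.sum_apply, Pi.smul_apply, smul_eq_mul, Finset.mul_sum]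
  rw [Finset.sum_comm]
  have : ∀ b, ∑ i, A r i * (s b * w b i) = s b * if r = b then 1 else 0 := fun b => by
    rw [← hA, Finset.mul_sum]
    exact Finset.sum_congr rfl fun i _ => by ring
  simp [this]

/-- The rank one matrices in the tensor product of the spans of the `u_r` and of the `v_s`. -/
def tensorFamilyCone {m n : ℕ} (u : Fin (m + 1) → ι → K) (v : Fin (n + 1) → κ → K) :
    Set (ι × κ → K) :=
  {x | ∃ (s : Fin (m + 1) → K) (t : Fin (n + 1) → K),
    x = tensor (∑ r, s r • u r) (∑ r, t r • v r)}

theorem tensorCone_eq (u u' : ι → K) (v v' : κ → K) :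
    tensorCone u u' v v' = tensorFamilyCone (m := 1) (n := 1) ![u, u'] ![v, v'] := by
  ext x
  constructor
  · rintro ⟨s, s', t, t', rfl⟩
    exact ⟨![s, s'], ![t, t'], by simp⟩
  · rintro ⟨s, t, rfl⟩
    exact ⟨s 0, s 1, t 0, t 1, by simp⟩

theorem rankLeOne_eq (m n : ℕ) :
    rankLeOne K (Fin (m + 1)) (Fin (n + 1)) =
      tensorFamilyCone (fun r => Pi.single r 1) (fun r => Pi.single r 1) := by
  have h : ∀ (k : ℕ) (u : Fin k → K), ∑ r, u r • (Pi.single r 1 : Fin k → K) = u := fun k u => by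
    ext j
    simp [Finset.sum_apply, Pi.single_apply]
  ext x
  constructor
  · rintro ⟨u, v, rfl⟩
    exact ⟨u, v, by rw [h, h]⟩
  · rintro ⟨s, t, rfl⟩
    exact ⟨_, _, rfl⟩

theorem smul_mem_tensorFamilyCone {m n : ℕ} {u : Fin (m + 1) → ι → K} {v : Fin (n + 1) → κ → K}
    (c : K) : ∀ x ∈ tensorFamilyCone u v, c • x ∈ tensorFamilyCone u v := by
  rintro _ ⟨s, t, rfl⟩
  exact ⟨c • s, t, by simp [smul_tensor, Finset.smul_sum, mul_smul]⟩

theorem zero_mem_tensorFamilyCone {m n : ℕ} {u : Fin (m + 1) → ι → K}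
    {v : Fin (n + 1) → κ → K} : 0 ∈ tensorFamilyCone u v :=
  ⟨0, 0, by simp [tensor_zero]⟩

theorem isPrime_vanishingIdeal_tensorFamilyCone [Infinite K] {m n : ℕ} (u : Fin (m + 1) → ι → K)
    (v : Fin (n + 1) → κ → K) :
    (MvPolynomial.vanishingIdeal K (tensorFamilyCone u v)).IsPrime := by
  have h : tensorFamilyCone u v = Set.range fun (y : Fin (m + 1) ⊕ Fin (n + 1) → K) ij =>
      MvPolynomial.eval y
        ((∑ r, MvPolynomial.X (Sum.inl r) * MvPolynomial.C (u r ij.1)) *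
          ∑ r, MvPolynomial.X (Sum.inr r) * MvPolynomial.C (v r ij.2)) := by
    ext x
    constructor
    · rintro ⟨s, t, rfl⟩
      refine ⟨Sum.elim s t, ?_⟩
      ext ⟨i, j⟩
      simp [Finset.sum_apply]
    · rintro ⟨y, rfl⟩
      refine ⟨fun r => y (Sum.inl r), fun r => y (Sum.inr r), ?_⟩
      ext ⟨i, j⟩
      simp [Finset.sum_apply]
  rw [h]
  exact isPrime_vanishingIdeal_range _

/-- Dual forms recover the products `s_r t_r'`. The first column and the rest of the first row of
this rank one matrix are `m + 1 + n` free parameters, and they determine it wherever the corner `s_0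
t_0` is nonzero. -/
theorem ringKrullDim_tensorFamilyCone [Infinite K] [Fintype ι] [Fintype κ] {m n : ℕ}
    {u : Fin (m + 1) → ι → K} {v : Fin (n + 1) → κ → K} (hu : LinearIndependent K u)
    (hv : LinearIndependent K v) :
    ringKrullDim (MvPolynomial (ι × κ) K ⧸
      MvPolynomial.vanishingIdeal K (tensorFamilyCone u v)) = (m + n + 1 : ℕ) := by
  obtain ⟨A, hA⟩ := exists_dual_family hu
  obtain ⟨B, hB⟩ := exists_dual_family hv
  let y : Fin (m + 1) → Fin (n + 1) → MvPolynomial (ι × κ) K := fun r r' =>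
    ∑ i, ∑ j, MvPolynomial.C (A r i * B r' j) * MvPolynomial.X (i, j)
  have hy : ∀ (s : Fin (m + 1) → K) (t : Fin (n + 1) → K) r r',
      MvPolynomial.eval (tensor (∑ r, s r • u r) (∑ r, t r • v r)) (y r r') =
      s r * t r' := by
    intro s t r r'
    simp only [y, map_sum, map_mul, MvPolynomial.eval_C, MvPolynomial.eval_X, tensor_apply]
    rw [← sum_dual_mul_sum hA s r, ← sum_dual_mul_sum hB t r', Finset.sum_mul_sum]
    exact Finset.sum_congr rfl fun i _ => Finset.sum_congr rfl fun j _ => by ring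
  let f : Fin (m + 1) ⊕ Fin n → MvPolynomial (ι × κ) K :=
    Sum.elim (fun r => y r 0) (fun r => y 0 r.succ)
  let Z : Fin (n + 1) → MvPolynomial (Fin (m + 1) ⊕ Fin n) K :=
    Fin.cons (MvPolynomial.X (Sum.inl 0)) fun r => MvPolynomial.X (Sum.inr r)
  have h := ringKrullDim_vanishingIdeal (isPrime_vanishingIdeal_tensorFamilyCone u v) f
    (MvPolynomial.X (Sum.inl 0)) (MvPolynomial.X_ne_zero _) ?_ ?_
  · rw [h]
    simp only [Nat.card_eq_fintype_card, Fintype.card_sum, Fintype.card_fin]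
    rw [add_right_comm m 1 n]
  · intro c hc
    rw [MvPolynomial.eval_X] at hc
    refine ⟨_, ⟨fun r => c (Sum.inl r),
      Fin.cons 1 fun r => c (Sum.inr r) / c (Sum.inl 0), rfl⟩, ?_⟩
    rintro (r | r)
    · simp only [f, Sum.elim_inl, hy, Fin.cons_zero, mul_one]
    · simp only [f, Sum.elim_inr, hy, Fin.cons_succ]
      field_simp
  · rintro ⟨i, j⟩
    -- This clears the denominator in `s_r t_r' = (s_r t_0)(s_0 t_r') / (s_0 t_0)`; `Z r'` stands
    -- for `s_0 t_r'`.
    refine ⟨MvPolynomial.X (Sum.inl 0),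
      ∑ r, ∑ r', MvPolynomial.C (u r i * v r' j) * (MvPolynomial.X (Sum.inl r) * Z r'),
      MvPolynomial.X_ne_zero _, ?_⟩
    rintro _ ⟨s, t, rfl⟩
    have hZ : ∀ r', MvPolynomial.eval (fun a => MvPolynomial.eval
        (tensor (∑ r, s r • u r) (∑ r, t r • v r)) (f a)) (Z r') = s 0 * t r' := by
      intro r'
      refine Fin.cases ?_ (fun r' => ?_) r'
      · simp only [Z, Fin.cons_zero, MvPolynomial.eval_X, f, Sum.elim_inl, hy]
      · simp only [Z, Fin.cons_succ, MvPolynomial.eval_X, f, Sum.elim_inr, hy]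
    simp only [map_sum, map_mul, hZ, MvPolynomial.eval_X, MvPolynomial.eval_C, f, Sum.elim_inl, hy,
      tensor_apply, Finset.sum_apply, Pi.smul_apply, smul_eq_mul]
    rw [Finset.sum_mul_sum, Finset.mul_sum]
    refine Finset.sum_congr rfl fun r _ => ?_
    rw [Finset.mul_sum]
    exact Finset.sum_congr rfl fun r' _ => by ring

theorem isPrime_vanishingIdeal_rankLeTwo [Infinite K] :
    (MvPolynomial.vanishingIdeal K (rankLeTwo K ι κ)).IsPrime := by
  have h : rankLeTwo K ι κ = Set.range fun (y : (ι ⊕ ι) ⊕ (κ ⊕ κ) → K) ij =>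
      MvPolynomial.eval y
        (MvPolynomial.X (Sum.inl (Sum.inl ij.1)) * MvPolynomial.X (Sum.inr (Sum.inl ij.2)) +
          MvPolynomial.X (Sum.inl (Sum.inr ij.1)) * MvPolynomial.X (Sum.inr (Sum.inr ij.2))) := by
    ext x
    constructor
    · rintro ⟨u, u', v, v', rfl⟩
      refine ⟨Sum.elim (Sum.elim u u') (Sum.elim v v'), ?_⟩
      ext ⟨i, j⟩
      simp
    · rintro ⟨y, rfl⟩
      refine ⟨fun i => y (Sum.inl (Sum.inl i)), fun i => y (Sum.inl (Sum.inr i)),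
        fun j => y (Sum.inr (Sum.inl j)), fun j => y (Sum.inr (Sum.inr j)), ?_⟩
      ext ⟨i, j⟩
      simp
  rw [h]
  exact isPrime_vanishingIdeal_range _

/-- A matrix of rank at most two with nonzero upper left 2 × 2 minor is determined by its first two
rows and first two columns, which can be prescribed freely: `2 (n + 2) + 2 m` entries. -/
theorem ringKrullDim_rankLeTwo [Infinite K] (m n : ℕ) :
    ringKrullDim (MvPolynomial (Fin (m + 2) × Fin (n + 2)) K ⧸
      MvPolynomial.vanishingIdeal K (rankLeTwo K (Fin (m + 2)) (Fin (n + 2)))) =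
        (2 * (m + n + 2) : ℕ) := by
  let S := (Fin (n + 2) ⊕ Fin (n + 2)) ⊕ (Fin m ⊕ Fin m)
  let p : S → Fin (m + 2) × Fin (n + 2) := Sum.elim (Sum.elim (fun j => (0, j)) fun j => (1, j))
    (Sum.elim (fun i => (i.succ.succ, 0)) fun i => (i.succ.succ, 1))
  let x0 : Fin (n + 2) → MvPolynomial S K := fun j => MvPolynomial.X (Sum.inl (Sum.inl j))
  let x1 : Fin (n + 2) → MvPolynomial S K := fun j => MvPolynomial.X (Sum.inl (Sum.inr j))
  let y0 : Fin m → MvPolynomial S K := fun i => MvPolynomial.X (Sum.inr (Sum.inl i))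
  let y1 : Fin m → MvPolynomial S K := fun i => MvPolynomial.X (Sum.inr (Sum.inr i))
  let Δ : MvPolynomial S K := x0 0 * x1 1 - x0 1 * x1 0
  have hΔ : Δ ≠ 0 := by
    intro h
    have := congrArg (MvPolynomial.eval
      (Sum.elim (Sum.elim (Pi.single 0 1) (Pi.single 1 1)) 0)) h
    simp [Δ, x0, x1] at this
  have h := ringKrullDim_vanishingIdeal
    (isPrime_vanishingIdeal_rankLeTwo (K := K) (ι := Fin (m + 2)) (κ := Fin (n + 2)))
    (fun s => MvPolynomial.X (p s)) Δ hΔ ?_ ?_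
  · rw [h]
    simp only [S, Nat.card_eq_fintype_card, Fintype.card_sum, Fintype.card_fin]
    rw [show n + 2 + (n + 2) + (m + m) = 2 * (m + n + 2) by ring]
  · intro c hc
    let a : Fin (n + 2) → K := fun j => c (Sum.inl (Sum.inl j))
    let b : Fin (n + 2) → K := fun j => c (Sum.inl (Sum.inr j))
    let d : Fin m → K := fun i => c (Sum.inr (Sum.inl i))
    let e : Fin m → K := fun i => c (Sum.inr (Sum.inr i))
    have hc : a 0 * b 1 - a 1 * b 0 ≠ 0 := by simpa [Δ, x0, x1] using hc
    -- The first two rows are `a` and `b`; Cramer's rule combines them into a row starting with `d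
    -- i`, `e i`.
    refine ⟨_, ⟨Fin.cons 1 (Fin.cons 0 fun i => (d i * b 1 - e i * b 0) / (a 0 * b 1 - a 1 * b 0)),
      Fin.cons 0 (Fin.cons 1 fun i => (a 0 * e i - a 1 * d i) / (a 0 * b 1 - a 1 * b 0)),
      a, b, rfl⟩, ?_⟩
    rintro ((j | j) | (i | i))
    · simp [p, a]
    · have : (1 : Fin (m + 2)) = Fin.succ 0 := rfl
      simp only [p, Sum.elim_inl, Sum.elim_inr, MvPolynomial.eval_X, Pi.add_apply, tensor_apply,
        this, Fin.cons_succ, Fin.cons_zero]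
      simp [b]
    · simp only [p, Sum.elim_inl, Sum.elim_inr, MvPolynomial.eval_X, Pi.add_apply, tensor_apply,
        Fin.cons_succ]
      change _ = d i
      rw [div_mul_eq_mul_div, div_mul_eq_mul_div, ← add_div, div_eq_iff hc]
      ring
    · simp only [p, Sum.elim_inr, MvPolynomial.eval_X, Pi.add_apply, tensor_apply,
        Fin.cons_succ]
      change _ = e i
      rw [div_mul_eq_mul_div, div_mul_eq_mul_div, ← add_div, div_eq_iff hc]
      ring
  · rintro ⟨i, j⟩
    refine Fin.cases ?_ (fun i => Fin.cases ?_ (fun i => ?_) i) i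
    · exact ⟨1, x0 j, one_ne_zero, by simp [x0, p]⟩
    · exact ⟨1, x1 j, one_ne_zero, by simp [x1, p]⟩
    -- This is the vanishing 3 × 3 minor on rows `0, 1, i + 2` and columns `0, 1, j`, solved for the
    -- corner entry.
    · refine ⟨Δ, (y0 i * x1 1 - y1 i * x1 0) * x0 j + (x0 0 * y1 i - x0 1 * y0 i) * x1 j, hΔ, ?_⟩
      rintro _ ⟨u, u', v, v', rfl⟩
      simp only [Δ, x0, x1, y0, y1, map_sub, map_add, map_mul, MvPolynomial.eval_X, p,
        Sum.elim_inl, Sum.elim_inr, Pi.add_apply, tensor_apply]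
      ring

end Dimension

end SecantLoci

end

/-! ### The secant stratification -/

open SecantLoci

theorem theorem4p4 (K : Type*) [Field K] [IsAlgClosed K] [CharZero K]
    (a b : ℕ) (ha : 1 ≤ a) (hb : 2 ≤ b) :
    (∀ q ∈ SecantLoci.secantVariety (SecantLoci.segreVariety K a b),
      q ∉ SecantLoci.segreVariety K a b →
        SecantLoci.IsSmoothQuadricSurface
          (SecantLoci.secantLocus (SecantLoci.segreVariety K a b) q)) ∧
    SecantLoci.secantVariety (SecantLoci.segreVariety K a b) =
      SecantLoci.tangentVariety (SecantLoci.segreVariety K a b) ∧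
    SecantLoci.HasDim (SecantLoci.tangentVariety (SecantLoci.segreVariety K a b))
      (2 * ((a : ℤ) + (b : ℤ)) - 1) ∧
    (Set.univ : Set (ℙ K (Fin (a + 1) × Fin (b + 1) → K))) =
      SecantLoci.secantStratum (SecantLoci.segreVariety K a b) (-1) ∪
      SecantLoci.secantStratum (SecantLoci.segreVariety K a b) 2 ∪
      SecantLoci.secantStratum (SecantLoci.segreVariety K a b) ((a : ℤ) + (b : ℤ)) ∧
    SecantLoci.secantStratum (SecantLoci.segreVariety K a b) 2 =
      SecantLoci.secantVariety (SecantLoci.segreVariety K a b) \ SecantLoci.segreVariety K a b ∧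
    SecantLoci.secantStratum (SecantLoci.segreVariety K a b) ((a : ℤ) + (b : ℤ)) =
      SecantLoci.segreVariety K a b := by

  have hne : Nontrivial (Fin (b + 1)) := Fin.nontrivial_iff_two_le.mpr (by lia)
  have hX := segreVariety_eq (K := K) a b
  have hsec := secantVariety_rankLeOne (K := K) (ι := Fin (a + 1)) (κ := Fin (b + 1))
  have htan := tangentVariety_rankLeOne (K := K) (ι := Fin (a + 1)) (κ := Fin (b + 1))
  have hbasis : ∀ k : ℕ, LinearIndependent K fun r : Fin k => (Pi.single r 1 : Fin k → K) :=
    fun k => Pi.linearIndependent_single_one (Fin k) K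
  have hdimX : HasDim (segreVariety K a b) ((a : ℤ) + b) := by
    have := hasDim_projSet smul_mem_tensorFamilyCone zero_mem_tensorFamilyCone
      (ringKrullDim_tensorFamilyCone (hbasis (a + 1)) (hbasis (b + 1)))
    rw [← rankLeOne_eq, ← hX] at this
    simpa using this
  have hlocus : ∀ q : ℙ K (Fin (a + 1) × Fin (b + 1) → K), q ∈ secantVariety (segreVariety K a b) →
      q ∉ segreVariety K a b → IsSmoothQuadricSurface (secantLocus (segreVariety K a b) q) ∧
        HasDim (secantLocus (segreVariety K a b) q) 2 := by
    intro q hq hqX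
    rw [hX, hsec] at hq
    rw [hX] at hqX ⊢
    obtain ⟨u, u', v, v', h⟩ := hq
    have hq1 : tensor u v + tensor u' v' ∉ rankLeOne K (Fin (a + 1)) (Fin (b + 1)) := by
      rw [← h]
      exact hqX
    have hu := linearIndependent_left hq1
    have hv := linearIndependent_right hq1
    rw [secantLocus_rankLeOne h hqX]
    refine ⟨isSmoothQuadricSurface_tensorCone hu hv, ?_⟩
    rw [tensorCone_eq]
    have := hasDim_projSet smul_mem_tensorFamilyCone zero_mem_tensorFamilyCone
      (ringKrullDim_tensorFamilyCone (m := 1) (n := 1) hu hv)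
    simpa using this
  have hempty : ∀ q : ℙ K (Fin (a + 1) × Fin (b + 1) → K), q ∉ secantVariety (segreVariety K a b) →
      HasDim (secantLocus (segreVariety K a b) q) (-1) := by
    intro q hq
    rw [hX, hsec] at hq
    rw [hX, secantLocus_eq_empty hq]
    exact hasDim_empty
  have hXsec : segreVariety K a b ⊆ secantVariety (segreVariety K a b) := by
    rw [hX, hsec]
    exact fun p hp => rankLeOne_subset_rankLeTwo hp
  refine ⟨fun q hq hqX => (hlocus q hq hqX).1, by rw [hX, hsec, htan], ?_, ?_, ?_, ?_⟩
  · rw [hX, htan]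
    -- With `a = m + 1` and `b = n + 1` the matrices have size `(m + 2) × (n + 2)`.
    obtain ⟨m, rfl⟩ := Nat.exists_eq_add_of_le' ha
    obtain ⟨n, rfl⟩ := Nat.exists_eq_add_of_le' (one_le_two.trans hb)
    have := hasDim_projSet smul_mem_rankLeTwo' zero_mem_rankLeTwo
      (ringKrullDim_rankLeTwo (K := K) m n)
    convert! this using 1
    push_cast
    ring
  · refine (Set.eq_univ_of_forall fun q => ?_).symm
    by_cases hqX : q ∈ segreVariety K a b
    · exact Or.inr (Or.inl ⟨hqX, hdimX⟩)
    · by_cases hq : q ∈ secantVariety (segreVariety K a b)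
      · exact Or.inl (Or.inr (Or.inr ⟨hqX, (hlocus q hq hqX).2⟩))
      · exact Or.inl (Or.inl (Or.inr ⟨hqX, hempty q hq⟩))
  · ext q
    constructor
    · rintro (⟨-, h⟩ | ⟨hqX, h⟩)
      -- A point of `X` would force `a + b = 2`, which `b ≥ 2` excludes; for `a = b = 1` the variety
      -- is itself a quadric surface.
      · have := hdimX.unique h
        lia
      · refine ⟨?_, hqX⟩
        by_contra hq
        exact absurd ((hempty q hq).unique h) (by norm_num)
    · rintro ⟨hq, hqX⟩
      exact Or.inr ⟨hqX, (hlocus q hq hqX).2⟩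
  · ext q
    constructor
    · rintro (⟨h, -⟩ | ⟨hqX, h⟩)
      · exact h
      · by_cases hq : q ∈ secantVariety (segreVariety K a b)
        · have := (hlocus q hq hqX).2.unique h
          lia
        · have := (hempty q hq).unique h
          lia
    · exact fun h => Or.inl ⟨h, hdimX⟩
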